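/- For integers $q\ge 1$ and $n\ge 0$ let $p_q(n)$ be the number of partitions of $n$ into exactly $q$ positive parts. A function $f:\mathbb N\to\mathbb Q$ ($\mathbb N=\{0,1,2,\dots\}$) is a quasi-polynomial of degree $d$ if $f(n)=\sum_{r=0}^{d}c_r(n)\,n^{d-r}$ for all $n\in\mathbb N$, with each $c_r:\mathbb N\to\mathbb Q$ periodic and $c_0$ not identically zero; $c_r$ is called its codegree $r$ coefficient (with $c_r=0$ for $r>d$). Let $g\in\mathbb Q[x]$ be integer-valued on $\mathbb Z$ and eventually nonnegative, let $S=\{q\in\mathbb N: g(q)\ge 0\}$, let $e:S\to\mathbb N\cup\{-1,\infty\}$, and let $p:\mathbb N\to\mathbb Z_{>0}$ with $p(r)\mid p(r+1)$ for all $r$. A family $\{f_q\}_{q\in S}$ is a two-level quasi-polynomial of degree $g$, depth $e$ and period $p$ if each $f_q$ is a quasi-polynomial of degree $g(q)$, with codegree $r$ coefficient $c_r(n,q)$, and there are polynomials $\phi_{r,i}\in\mathbb Q[x]$ ($r\ge 0$, $0\le i<p(r)$) such that $c_r(n,q)=\phi_{r,\,n\bmod p(r)}(q)$ for all $n\in\mathbb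 N$, $q\in S$ and $0\le r\le e(q)$. For $q\in\mathbb N\setminus S$ one sets $f_q=0$ and $e(q)=-1$. **Theorem.** There is a two-level quasi-polynomial $\{f_q\}$ of degree $q-1$, depth $\lfloor (q-1)/2\rfloor$ and period one (i.e. $p(r)=1$ for all $r$) such that $$f_q(n)=q!\,(q-1)!\,p_q(n)$$ for all integers $q\ge 1$ and $n\ge 0$ with $(q,n)\ne(1,0)$. -/

import Mathlib

/-- `g ∈ ℚ[x]` is a numerical polynomial: it takes integer values at all integers. -/
def IsNumericalPolynomial (g : Polynomial ℚ) : Prop :=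
  ∀ q : ℤ, ∃ k : ℤ, g.eval (q : ℚ) = (k : ℚ)

/-- `c r` (for `r = 0, 1, 2, …`) are the codegree `r` coefficient functions exhibiting
`f : ℕ → ℚ` as a quasi-polynomial of degree `d`: each `c r` is periodic, `c 0` is not identically
zero, `c r = 0` for `r > d`, and `f n = ∑ r ≤ d, c r n * n ^ (d - r)` for every natural `n`
(with `0 ^ 0 = 1`).  Such coefficient functions are uniquely determined by `f` and `d`. -/
structure IsQuasiPolynomialExpansion (f : ℕ → ℚ) (d : ℕ) (c : ℕ → ℕ → ℚ) : Prop where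
  periodic : ∀ r, ∃ m : ℕ, 0 < m ∧ Function.Periodic (c r) m
  leading_ne_zero : ∃ n, c 0 n ≠ 0
  eq_zero_of_lt : ∀ r, d < r → ∀ n, c r n = 0
  eq_sum : ∀ n : ℕ, f n = ∑ r ∈ Finset.range (d + 1), c r n * (n : ℚ) ^ (d - r)

/-- The index set `S = {q ∈ ℕ : g(q) ≥ 0}` attached to a degree function `g`. -/
def degreeSupport (g : Polynomial ℚ) : Set ℕ :=
  {q : ℕ | 0 ≤ g.eval (q : ℚ)}

/-- `f` (a family `f q : ℕ → ℚ`) is a two-level quasi-polynomial of degree `g`, depth `e` and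
period `p`.  The depth takes values in `{-1, 0, 1, 2, …} ∪ {∞}`, a subset of `WithTop ℤ`.
On the index set `S` attached to `g`, `f q` is a quasi-polynomial of degree `g(q)` and, for all
`r ≤ e q`, its codegree `r` coefficient at `n` is `φ r (n mod p r)` evaluated at `q`, where the
polynomials `φ r i` do not depend on `q` or `n`.  Outside `S`, `f q = 0` and `e q = -1`. -/
structure IsTwoLevelQuasiPolynomial (g : Polynomial ℚ) (e : ℕ → WithTop ℤ) (p : ℕ → ℕ)
    (f : ℕ → ℕ → ℚ) : Prop where
  numerical : IsNumericalPolynomial g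
  eventually_nonneg : ∀ᶠ q : ℕ in Filter.atTop, 0 ≤ g.eval (q : ℚ)
  depth_ge : ∀ q, ((-1 : ℤ) : WithTop ℤ) ≤ e q
  period_pos : ∀ r, 0 < p r
  period_dvd : ∀ r, p r ∣ p (r + 1)
  exists_coeff : ∃ φ : ℕ → ℕ → Polynomial ℚ, ∀ q ∈ degreeSupport g, ∃ (d : ℕ) (c : ℕ → ℕ → ℚ),
    (d : ℚ) = g.eval (q : ℚ) ∧ IsQuasiPolynomialExpansion (f q) d c ∧
      ∀ n r : ℕ, ((r : ℤ) : WithTop ℤ) ≤ e q → c r n = (φ r (n % p r)).eval (q : ℚ)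
  eq_zero_of_notMem : ∀ q ∉ degreeSupport g, ∀ n, f q n = 0
  depth_of_notMem : ∀ q ∉ degreeSupport g, e q = ((-1 : ℤ) : WithTop ℤ)

/-- The number of partitions of `n` into exactly `q` (positive) parts. -/
def numPartitions (q n : ℕ) : ℕ :=
  (Finset.univ.filter fun P : Nat.Partition n => P.parts.card = q).card

/-! Removing a part one, or lowering all parts, gives p_{k+1}(n+k+1) = p_k(n+k) + p_{k+1}(n).
`exists_polynomial_step` turns this into polynomials A_k, the non-oscillating part of p_{k+1}, with
A_{k+1}(x+k+2) - A_{k+1}(x) = A_k(x+k+1). The remainder is killed by ∏_{j≤k+1} (E^j-1)/(E-1), E the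
shift. Roots of unity other than 1 have multiplicity at most (k+1)/2 there (`geomProd_dvd`), so the
remainder has degree below ⌊(k+1)/2⌋ and misses every codegree r ≤ ⌊k/2⌋. In those codegrees only
A_k counts. Comparing coefficients in its recurrence expresses the first difference in k of
(k+1)!(k-r)![x^{k-r}]A_k through smaller r, so this is a polynomial in k
(`exists_polynomial_normalizedCoeff`). -/

/-! ### Difference equations for polynomials -/

open Polynomial in
/-- The first difference with step `h ≠ 0` is surjective on polynomials over `ℚ` and raises
degrees by one. -/
theorem exists_taylor_sub_eq {h : ℚ} (hh : h ≠ 0) (d : ℕ) (P : ℚ[X]) (hP : P.natDegree ≤ d) :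
    ∃ Q : ℚ[X], Q.natDegree ≤ d + 1 ∧ taylor h Q - Q = P := by
  -- B_{i+1}(y+1) - B_{i+1}(y) = (i+1)y^i solves the step-one equation for P(hy); substituting y =
  -- x/h restores the step.
  set R : ℚ[X] := ∑ i ∈ Finset.range (d + 1),
    C (P.coeff i * h ^ i / (i + 1)) * Polynomial.bernoulli (i + 1) with hR
  refine ⟨R.comp (C h⁻¹ * X), ?_, ?_⟩
  · refine natDegree_comp_le.trans ?_
    have h1 : (C h⁻¹ * X : ℚ[X]).natDegree ≤ 1 := (natDegree_C_mul_le _ _).trans natDegree_X_le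
    have h2 : R.natDegree ≤ d + 1 := by
      refine natDegree_sum_le_of_forall_le _ _ fun i hi => ?_
      refine (natDegree_C_mul_le _ _).trans ?_
      refine natDegree_le_iff_coeff_eq_zero.2 fun N hN => ?_
      rw [Polynomial.coeff_bernoulli, if_neg]
      have := Finset.mem_range.1 hi
      omega
    nlinarith
  · refine Polynomial.funext fun x => ?_
    have key : ∀ y : ℚ, R.eval (1 + y) - R.eval y = P.eval (h * y) := by
      intro y
      rw [hR, eval_finsetSum, eval_finsetSum, ← Finset.sum_sub_distrib,
        eval_eq_sum_range' (Nat.lt_succ_of_le hP)]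
      refine Finset.sum_congr rfl fun i _ => ?_
      simp only [eval_mul, eval_C, Polynomial.bernoulli_eval_one_add]
      have : (i : ℚ) + 1 ≠ 0 := by positivity
      push_cast
      rw [mul_pow]
      field_simp
      ring
    have := key (h⁻¹ * x)
    rw [mul_inv_cancel_left₀ hh] at this
    rw [← this, eval_sub, taylor_eval]
    simp only [eval_comp, eval_mul, eval_C, eval_X]
    congr 2
    field_simp
    ring

open Polynomial in
/-- A rational sequence whose differences are eventually given by a polynomial is eventually
given by a polynomial, with the same starting point. -/
theorem exists_polynomial_of_succ_sub {u : ℕ → ℚ} {T : ℚ[X]} {k₀ : ℕ}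
    (h : ∀ k, k₀ ≤ k → u (k + 1) = u k + T.eval (k : ℚ)) :
    ∃ S : ℚ[X], ∀ k, k₀ ≤ k → u k = S.eval (k : ℚ) := by
  obtain ⟨Q, -, hQ⟩ := exists_taylor_sub_eq one_ne_zero _ T le_rfl
  refine ⟨Q + C (u k₀ - Q.eval (k₀ : ℚ)), fun k hk => ?_⟩
  induction k, hk using Nat.le_induction with
  | base => simp
  | succ k hk ih =>
    have := congrArg (eval (k : ℚ)) hQ
    rw [eval_sub, taylor_eval] at this
    rw [h k hk, ih, ← this]
    simp
    ring

open Polynomial in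
/-- Coefficients of a translated polynomial, in the factorial normalization. -/
theorem factorial_mul_coeff_taylor (h : ℚ) (Q : ℚ[X]) {k m : ℕ} (hQ : Q.natDegree < k + m) :
    (k.factorial : ℚ) * (taylor h Q).coeff k =
      ∑ j ∈ Finset.range m, ((k + j).factorial : ℚ) * Q.coeff (k + j) * h ^ j / j.factorial := by
  rcases Nat.eq_zero_or_pos m with rfl | hm
  · rw [coeff_eq_zero_of_natDegree_lt (by rwa [natDegree_taylor])]
    simp
  have hd : (hasseDeriv k Q).natDegree < m := by
    have := natDegree_hasseDeriv_le Q k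
    omega
  rw [taylor_coeff, eval_eq_sum_range' hd, Finset.mul_sum]
  refine Finset.sum_congr rfl fun j _ => ?_
  rw [hasseDeriv_coeff, add_comm j k, Nat.cast_add_choose ℚ]
  have := Nat.cast_ne_zero (R := ℚ).2 k.factorial_ne_zero
  have := Nat.cast_ne_zero (R := ℚ).2 j.factorial_ne_zero
  field_simp

/-! ### Top coefficients as polynomials in the index -/

open Polynomial in
/-- The normalized coefficient of codegree `r` of the `k`-th member of a sequence of
polynomials. -/
def normalizedCoeff (A : ℕ → ℚ[X]) (k r : ℕ) : ℚ :=
  ((k + 1).factorial : ℚ) * ((k - r).factorial : ℚ) * (A k).coeff (k - r)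

-- Compare coefficients of x^{k-R} in `hrec`, times (k-R)!(k+1)!. The factor (k+2)! on the left
-- absorbs one power of the step k+2, so both i = 0 terms have weight one.
open Polynomial in
theorem sum_normalizedCoeff_succ {A : ℕ → ℚ[X]} (hdeg : ∀ k, (A k).natDegree ≤ k)
    (hrec : ∀ k : ℕ, taylor ((k : ℚ) + 2) (A (k + 1)) - A (k + 1) = taylor ((k : ℚ) + 1) (A k))
    {k R : ℕ} (hR : R ≤ k) :
    ∑ i ∈ Finset.range (R + 1),
        normalizedCoeff A (k + 1) (R - i) * ((k : ℚ) + 2) ^ i / (i + 1).factorial =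
      ∑ i ∈ Finset.range (R + 1),
        normalizedCoeff A k (R - i) * ((k : ℚ) + 1) ^ i / i.factorial := by
  obtain ⟨l, rfl⟩ := Nat.exists_eq_add_of_le' hR
  have h := congrArg (fun P : ℚ[X] => (l.factorial : ℚ) * P.coeff l) (hrec (l + R))
  simp only [coeff_sub, mul_sub] at h
  have hd1 := hdeg (l + R + 1)
  have hd2 := hdeg (l + R)
  rw [factorial_mul_coeff_taylor (m := R + 1 + 1) _ _ (by omega),
    factorial_mul_coeff_taylor (m := R + 1) _ _ (by omega), Finset.sum_range_succ'] at h
  simp only [add_zero, pow_zero, mul_one, Nat.factorial_zero, Nat.cast_one, div_one,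
    add_sub_cancel_right] at h
  have h' := congrArg (fun x : ℚ => ((l + R + 1).factorial : ℚ) * x) h
  simp only [Finset.mul_sum] at h'
  refine (Finset.sum_congr rfl fun i hi => ?_).trans (h'.trans
    (Finset.sum_congr rfl fun i hi => ?_))
  · have := Finset.mem_range.1 hi
    rw [normalizedCoeff, show l + R + 1 - (R - i) = l + (i + 1) by omega,
      Nat.factorial_succ (l + R + 1)]
    push_cast
    ring
  · have := Finset.mem_range.1 hi
    rw [normalizedCoeff, show l + R - (R - i) = l + i by omega]
    ring

open Polynomial in
/-- The normalized coefficients are polynomials in the index of the sequence. -/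
theorem exists_polynomial_normalizedCoeff {A : ℕ → ℚ[X]} (hdeg : ∀ k, (A k).natDegree ≤ k)
    (hrec : ∀ k : ℕ, taylor ((k : ℚ) + 2) (A (k + 1)) - A (k + 1) = taylor ((k : ℚ) + 1) (A k))
    (R : ℕ) : ∃ S : ℚ[X], ∀ k, R ≤ k → normalizedCoeff A k R = S.eval (k : ℚ) := by
  induction R using Nat.strong_induction_on with
  | _ R ih =>
    choose! S hS using ih
    refine exists_polynomial_of_succ_sub
      -- The terms i ≥ 1 of the coefficient identity, all of codegree below R.
      (T := ∑ i ∈ Finset.range R, (C ((i + 1).factorial : ℚ)⁻¹ * S (R - (i + 1)) * (X + 1) ^ (i + 1)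
        - C ((i + 1 + 1).factorial : ℚ)⁻¹ * (S (R - (i + 1))).comp (X + 1) * (X + 2) ^ (i + 1)))
      fun k hk => ?_
    have h := sum_normalizedCoeff_succ hdeg hrec hk
    rw [Finset.sum_range_succ', Finset.sum_range_succ'] at h
    simp only [Nat.sub_zero, pow_zero, mul_one, zero_add, Nat.factorial_one, Nat.factorial_zero,
      Nat.cast_one, div_one] at h
    rw [eval_finsetSum]
    simp only [eval_sub, eval_mul, eval_C, eval_pow, eval_add, eval_X, eval_one, eval_comp,
      eval_ofNat]
    rw [Finset.sum_sub_distrib]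
    have e1 : ∀ i ∈ Finset.range R, ((i + 1).factorial : ℚ)⁻¹ * (S (R - (i + 1))).eval (k : ℚ) *
        ((k : ℚ) + 1) ^ (i + 1) =
        normalizedCoeff A k (R - (i + 1)) * ((k : ℚ) + 1) ^ (i + 1) / (i + 1).factorial := by
      intro i hi
      have := Finset.mem_range.1 hi
      rw [hS (R - (i + 1)) (by omega) k (by omega)]
      ring
    have e2 : ∀ i ∈ Finset.range R, ((i + 1 + 1).factorial : ℚ)⁻¹ *
        (S (R - (i + 1))).eval ((k : ℚ) + 1) * ((k : ℚ) + 2) ^ (i + 1) =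
        normalizedCoeff A (k + 1) (R - (i + 1)) * ((k : ℚ) + 2) ^ (i + 1) /
          (i + 1 + 1).factorial := by
      intro i hi
      have := Finset.mem_range.1 hi
      rw [hS (R - (i + 1)) (by omega) (k + 1) (by omega)]
      push_cast
      ring
    rw [Finset.sum_congr rfl e1, Finset.sum_congr rfl e2]
    linarith

open Polynomial in
theorem normalizedCoeff_zero_eq {A : ℕ → ℚ[X]} (hdeg : ∀ k, (A k).natDegree ≤ k)
    (hrec : ∀ k : ℕ, taylor ((k : ℚ) + 2) (A (k + 1)) - A (k + 1) = taylor ((k : ℚ) + 1) (A k))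
    (k : ℕ) : normalizedCoeff A k 0 = normalizedCoeff A 0 0 := by
  induction k with
  | zero => rfl
  | succ k ih =>
    have := sum_normalizedCoeff_succ hdeg hrec (Nat.zero_le k)
    simpa [ih] using this

/-! ### Shift operators and periodic coefficients -/

/-- The shift operator on rational sequences. -/
def seqShift : Module.End ℚ (ℕ → ℚ) := LinearMap.funLeft ℚ ℚ (· + 1)

theorem seqShift_pow_apply (j : ℕ) (f : ℕ → ℚ) (n : ℕ) : (seqShift ^ j) f n = f (n + j) := by
  induction j generalizing n with
  | zero => rfl
  | succ j ih =>
    rw [pow_succ', Module.End.mul_apply]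
    change (seqShift ^ j) f (n + 1) = _
    rw [ih, add_right_comm, add_assoc]

open Polynomial in
theorem aeval_seqShift_X_pow_sub_one (N : ℕ) (f : ℕ → ℚ) (n : ℕ) :
    aeval seqShift (X ^ N - 1 : ℚ[X]) f n = f (n + N) - f n := by
  simp [seqShift_pow_apply]

open Polynomial in
theorem aeval_seqShift_const (P : ℚ[X]) (c : ℚ) :
    aeval seqShift P (fun _ => c) = fun _ => P.eval 1 * c := by
  funext n
  rw [aeval_eq_sum_range, eval_eq_sum_range, LinearMap.sum_apply, Finset.sum_apply,
    Finset.sum_mul]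
  refine Finset.sum_congr rfl fun i _ => ?_
  simp [seqShift_pow_apply]

open Polynomial in
/-- The product `∏_{j ≤ q} (X ^ j - 1) / (X - 1)`. -/
noncomputable def geomProd (q : ℕ) : ℚ[X] :=
  ∏ j ∈ Finset.range q, ∑ i ∈ Finset.range (j + 1), X ^ i

open Polynomial in
theorem X_sub_one_mul_geomProd_succ (q : ℕ) :
    (X - 1) * geomProd (q + 1) = geomProd q * (X ^ (q + 1) - 1) := by
  rw [geomProd, Finset.prod_range_succ, ← geom_sum_mul, geomProd]
  ring

open Polynomial in
theorem eval_one_geomProd_ne_zero (q : ℕ) : (geomProd q).eval 1 ≠ 0 := by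
  rw [geomProd, eval_prod]
  refine Finset.prod_ne_zero_iff.2 fun j _ => ?_
  simp only [eval_finsetSum, eval_pow, eval_X, one_pow, Finset.sum_const, Finset.card_range,
    nsmul_eq_mul, mul_one]
  positivity

-- For d ≥ 2, Φ_d divides 1 + ... + X^j exactly when d ∣ j+1, so its multiplicity in the product is
-- ⌊q/d⌋ ≤ ⌊q/2⌋. This bound yields the depth.
open Polynomial in
theorem geomProd_dvd (q : ℕ) : geomProd q ∣ (X ^ q.factorial - 1) ^ (q / 2) := by
  have h1 : geomProd q = ∏ d ∈ Finset.Icc 2 q, cyclotomic d ℚ ^ (q / d) := by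
    have h : ∀ j ∈ Finset.range q, (∑ i ∈ Finset.range (j + 1), X ^ i : ℚ[X]) =
        ∏ d ∈ Finset.Icc 2 q, if d ∣ j + 1 then cyclotomic d ℚ else 1 := by
      intro j hj
      rw [← prod_cyclotomic_eq_geom_sum j.succ_pos, ← Finset.prod_filter]
      refine Finset.prod_congr ?_ fun _ _ => rfl
      ext d
      have hj' := Finset.mem_range.1 hj
      simp only [Finset.mem_erase, Nat.mem_divisors, Finset.mem_filter, Finset.mem_Icc]
      constructor
      · rintro ⟨hd, hdj, -⟩
        have := Nat.le_of_dvd j.succ_pos hdj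
        have := Nat.pos_of_dvd_of_pos hdj j.succ_pos
        exact ⟨⟨by omega, by omega⟩, hdj⟩
      · rintro ⟨⟨h2, -⟩, hdj⟩
        exact ⟨by omega, hdj, j.succ_ne_zero⟩
    rw [geomProd, Finset.prod_congr rfl h, Finset.prod_comm]
    refine Finset.prod_congr rfl fun d _ => ?_
    rw [← Finset.prod_filter, Finset.prod_const, Nat.card_multiples]
  have h2 : ∏ d ∈ Finset.Icc 2 q, cyclotomic d ℚ ∣ X ^ q.factorial - 1 := by
    rw [← prod_cyclotomic_eq_X_pow_sub_one q.factorial_pos]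
    refine Finset.prod_dvd_prod_of_subset _ _ _ fun d hd => ?_
    obtain ⟨hd2, hdq⟩ := Finset.mem_Icc.1 hd
    exact Nat.mem_divisors.2 ⟨Nat.dvd_factorial (by omega) hdq, q.factorial_ne_zero⟩
  refine dvd_trans ?_ (pow_dvd_pow_of_dvd h2 _)
  rw [h1, ← Finset.prod_pow]
  refine Finset.prod_dvd_prod_of_dvd _ _ fun d hd => pow_dvd_pow _ ?_
  exact Nat.div_le_div_left (Finset.mem_Icc.1 hd).1 two_pos

open Polynomial in
/-- A sequence killed by `(E ^ N - 1) ^ m`, for the shift `E`, is a quasi-polynomial of degree less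
than `m` and period `N`. -/
theorem exists_periodic_coeff_of_aeval_eq_zero {N m : ℕ} (hN : 0 < N) {f : ℕ → ℚ}
    (hf : aeval seqShift ((X ^ N - 1) ^ m : ℚ[X]) f = 0) :
    ∃ β : ℕ → ℕ → ℚ, (∀ j, Function.Periodic (β j) N) ∧ (∀ j, m ≤ j → β j = 0) ∧
      ∀ n, f n = ∑ j ∈ Finset.range m, β j n * (n : ℚ) ^ j := by
  have hop : ∀ k, aeval seqShift ((X ^ N - 1) ^ k : ℚ[X]) f = (fwdDiff N)^[k] f := by
    intro k
    induction k with
    | zero => simp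
    | succ k ih =>
      rw [pow_succ', map_mul, Module.End.mul_apply, ih, Function.iterate_succ_apply']
      exact funext fun n => aeval_seqShift_X_pow_sub_one N _ n
  have hzero : ∀ k, m ≤ k → (fwdDiff N)^[k] f = 0 := by
    intro k hk
    rw [← hop, ← Nat.sub_add_cancel hk, pow_add, map_mul, Module.End.mul_apply, hf, map_zero]
  -- Newton interpolation with step N on the residue class of b.
  let P : ℕ → ℚ[X] := fun b => ∑ k ∈ Finset.range m,
    C ((fwdDiff N)^[k] f b / k.factorial) *
      (descPochhammer ℚ k).comp (C (N : ℚ)⁻¹ * (X - C (b : ℚ)))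
  have hPdeg : ∀ b j, m ≤ j → (P b).coeff j = 0 := by
    intro b j hj
    rw [finsetSum_coeff]
    refine Finset.sum_eq_zero fun k hk => ?_
    rw [coeff_C_mul, coeff_eq_zero_of_natDegree_lt, mul_zero]
    refine lt_of_le_of_lt natDegree_comp_le ?_
    rw [descPochhammer_natDegree]
    have h1 : (C (N : ℚ)⁻¹ * (X - C (b : ℚ))).natDegree ≤ 1 := by
      refine (natDegree_C_mul_le _ _).trans ?_
      rw [natDegree_X_sub_C]
    have := Finset.mem_range.1 hk
    nlinarith
  refine ⟨fun j n => (P (n % N)).coeff j, fun j n => by simp, fun j hj => ?_, fun n => ?_⟩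
  · funext n
    exact hPdeg _ _ hj
  · rcases Nat.eq_zero_or_pos m with rfl | hm
    · simpa using congrFun (hzero 0 le_rfl) n
    have hd : (P (n % N)).natDegree < m := by
      by_contra! hcon
      have h0 : P (n % N) = 0 := leadingCoeff_eq_zero.1 (hPdeg _ _ hcon)
      rw [h0, natDegree_zero] at hcon
      omega
    rw [← eval_eq_sum_range' hd]
    have hn : n % N + (n / N) • N = n := by
      rw [smul_eq_mul, mul_comm, Nat.mod_add_div]
    have hsub : (N : ℚ)⁻¹ * ((n : ℚ) - (n % N : ℕ)) = ((n / N : ℕ) : ℚ) := by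
      have hN' : (N : ℚ) ≠ 0 := by positivity
      have := congrArg (Nat.cast (R := ℚ)) hn
      rw [smul_eq_mul] at this
      push_cast at this
      rw [← this]
      field_simp
      ring
    have hsum := shift_eq_sum_fwdDiff_iter N f (n / N) (n % N)
    rw [hn] at hsum
    rw [hsum, eval_finsetSum]
    trans ∑ k ∈ Finset.range (n / N + 1 + m), (n / N).choose k • (fwdDiff N)^[k] f (n % N)
    · refine Finset.sum_subset (Finset.range_subset_range.2 (Nat.le_add_right _ _)) fun k _ hk => ?_
      rw [Nat.choose_eq_zero_of_lt (by simpa using hk), zero_smul]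
    · symm
      refine (Finset.sum_congr rfl fun k _ => ?_).trans
        (Finset.sum_subset (Finset.range_subset_range.2 (Nat.le_add_left _ _)) fun k _ hk => ?_)
      · simp only [eval_mul, eval_C, eval_comp, eval_sub, eval_X]
        rw [hsub, descPochhammer_eval_eq_descFactorial, Nat.descFactorial_eq_factorial_mul_choose,
          nsmul_eq_mul]
        have := Nat.cast_ne_zero (R := ℚ).2 k.factorial_ne_zero
        push_cast
        field_simp
      · rw [hzero k (by simpa using hk)]
        simp

/-! ### Recurrence for partitions -/

/-- Partitions of `n + q + 1` into `q + 1` parts either have a part equal to one, to be removed,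
or stay partitions into `q + 1` parts after lowering each part by one. -/
theorem numPartitions_succ_add (q n : ℕ) :
    numPartitions (q + 1) (n + (q + 1)) = numPartitions q (n + q) + numPartitions (q + 1) n := by
  unfold numPartitions
  rw [← Finset.card_filter_add_card_filter_not (fun P : Nat.Partition (n + (q + 1)) => 1 ∈ P.parts)]
  congr 1
  · symm
    refine Finset.card_bij (fun P _ => ⟨1 ::ₘ P.parts, ?_, ?_⟩) ?_ ?_ ?_
    · intro i hi
      rcases Multiset.mem_cons.1 hi with rfl | hi
      · exact one_pos
      · exact P.parts_pos hi
    · rw [Multiset.sum_cons, P.parts_sum]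
      omega
    · intro P hP
      simpa using hP
    · intro P _ P' _ h
      have := congrArg Nat.Partition.parts h
      exact Nat.Partition.ext ((Multiset.cons_inj_right 1).1 this)
    · intro Q hQ
      simp only [Finset.mem_filter, Finset.mem_univ, true_and] at hQ
      obtain ⟨hc, h1⟩ := hQ
      have he := Multiset.cons_erase h1
      refine ⟨⟨Q.parts.erase 1, fun hi => Q.parts_pos (Multiset.mem_of_mem_erase hi), ?_⟩, ?_, ?_⟩
      · have := congrArg Multiset.sum he
        rw [Multiset.sum_cons, Q.parts_sum] at this
        omega
      · simp only [Finset.mem_filter, Finset.mem_univ, true_and]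
        rw [Multiset.card_erase_of_mem h1, hc, Nat.pred_succ]
      · exact Nat.Partition.ext he
  · symm
    refine Finset.card_bij (fun P hP => ⟨P.parts.map (· + 1), ?_, ?_⟩) ?_ ?_ ?_
    · intro i hi
      obtain ⟨j, -, rfl⟩ := Multiset.mem_map.1 hi
      exact j.succ_pos
    · simp only [Finset.mem_filter, Finset.mem_univ, true_and] at hP
      rw [Multiset.sum_map_add, Multiset.map_id', P.parts_sum, Multiset.map_const',
        Multiset.sum_replicate, hP, smul_eq_mul, mul_one]
    · intro P hP
      simp only [Finset.mem_filter, Finset.mem_univ, true_and] at hP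
      simp only [Finset.mem_filter, Finset.mem_univ, true_and, Multiset.card_map, Multiset.mem_map]
      refine ⟨hP, ?_⟩
      rintro ⟨j, hj, h⟩
      have := P.parts_pos hj
      omega
    · intro P _ P' _ h
      have := congrArg Nat.Partition.parts h
      exact Nat.Partition.ext (Multiset.map_injective (add_left_injective 1) this)
    · intro Q hQ
      simp only [Finset.mem_filter, Finset.mem_univ, true_and] at hQ
      obtain ⟨hc, h1⟩ := hQ
      have he : (Q.parts.map (· - 1)).map (· + 1) = Q.parts := by
        rw [Multiset.map_map]
        conv_rhs => rw [← Multiset.map_id Q.parts]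
        refine Multiset.map_congr rfl fun i hi => ?_
        exact Nat.sub_add_cancel (Q.parts_pos hi)
      refine ⟨⟨Q.parts.map (· - 1), fun {i} hi => ?_, ?_⟩, ?_, ?_⟩
      · obtain ⟨j, hj, rfl⟩ := Multiset.mem_map.1 hi
        have := Q.parts_pos hj
        have : j ≠ 1 := fun h => h1 (h ▸ hj)
        omega
      · have := congrArg Multiset.sum he
        rw [Multiset.sum_map_add, Multiset.map_id', Q.parts_sum, Multiset.map_const',
          Multiset.sum_replicate, Multiset.card_map, hc, smul_eq_mul, mul_one] at this
        omega
      · simpa using hc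
      · exact Nat.Partition.ext he

theorem numPartitions_zero_succ (n : ℕ) : numPartitions 0 (n + 1) = 0 := by
  rw [numPartitions, Finset.card_eq_zero, Finset.filter_eq_empty_iff]
  intro P _ h
  have := P.parts_sum
  rw [Multiset.card_eq_zero.1 h] at this
  simp at this

theorem numPartitions_zero_zero : numPartitions 0 0 = 1 := by
  rw [numPartitions, Finset.card_eq_one]
  refine ⟨default, Finset.eq_singleton_iff_unique_mem.2 ⟨?_, fun P _ => Subsingleton.elim _ _⟩⟩
  simp

theorem numPartitions_succ_zero (q : ℕ) : numPartitions (q + 1) 0 = 0 := by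
  rw [numPartitions, Finset.card_eq_zero, Finset.filter_eq_empty_iff]
  intro P _ h
  simp at h

theorem numPartitions_one_succ (n : ℕ) : numPartitions 1 (n + 1) = 1 := by
  have h := numPartitions_succ_add 0 n
  rw [zero_add, add_zero] at h
  induction n with
  | zero => rw [h, numPartitions_zero_zero, numPartitions_succ_zero]
  | succ n ih =>
    rw [h, numPartitions_zero_succ, ih]
    have := numPartitions_succ_add 0 n
    rwa [zero_add, add_zero] at this

/-- The number of partitions of `n` into `k + 1` parts, with the value at `k = n = 0` changed
to one. -/
def adjustedNumPartitions (k n : ℕ) : ℚ :=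
  if k = 0 then 1 else numPartitions (k + 1) n

/-- The row k = 0 enters only at the positive argument n+1, so the changed value does no harm. -/
theorem adjustedNumPartitions_succ_add (k n : ℕ) :
    adjustedNumPartitions (k + 1) (n + (k + 2)) =
      adjustedNumPartitions k (n + (k + 1)) + adjustedNumPartitions (k + 1) n := by
  simp only [adjustedNumPartitions, k.succ_ne_zero, if_false]
  rw [numPartitions_succ_add (k + 1) n]
  split_ifs with hk
  · subst hk
    rw [zero_add, numPartitions_one_succ]
    norm_num
  · push_cast
    rfl

/-! ### Splitting off the polynomial part -/

-- Any solution Q of the difference equation leaves a remainder that the new product sends to a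
-- constant sequence. The product does not vanish at 1, so adding a constant to Q makes that
-- sequence zero.
open Polynomial in
theorem exists_polynomial_step (k : ℕ) (A : ℚ[X]) (hA : A.natDegree ≤ k)
    (hB : aeval seqShift (geomProd (k + 1))
      (fun n => adjustedNumPartitions k n - A.eval (n : ℚ)) = 0) :
    ∃ A' : ℚ[X], (A'.natDegree ≤ k + 1 ∧ aeval seqShift (geomProd (k + 1 + 1))
      (fun n => adjustedNumPartitions (k + 1) n - A'.eval (n : ℚ)) = 0) ∧
      taylor ((k : ℚ) + 2) A' - A' = taylor ((k : ℚ) + 1) A := by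
  obtain ⟨Q, hQ, hQA⟩ := exists_taylor_sub_eq (h := (k : ℚ) + 2) (by positivity) k
    (taylor ((k : ℚ) + 1) A) (by rwa [natDegree_taylor])
  set h : ℕ → ℚ := fun n => adjustedNumPartitions (k + 1) n - Q.eval (n : ℚ) with hh
  have h1 : aeval seqShift (X ^ (k + 1 + 1) - 1 : ℚ[X]) h =
      (seqShift ^ (k + 1)) (fun n => adjustedNumPartitions k n - A.eval (n : ℚ)) := by
    funext n
    rw [aeval_seqShift_X_pow_sub_one, seqShift_pow_apply]
    have := congrArg (eval (n : ℚ)) hQA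
    rw [eval_sub, taylor_eval, taylor_eval] at this
    simp only [hh]
    rw [show n + (k + 1 + 1) = n + (k + 2) from rfl, adjustedNumPartitions_succ_add]
    push_cast
    linarith
  have h2 : aeval seqShift ((X - 1) * geomProd (k + 1 + 1) : ℚ[X]) h = 0 := by
    rw [X_sub_one_mul_geomProd_succ, map_mul, Module.End.mul_apply, h1]
    have : seqShift ^ (k + 1) = aeval seqShift (X ^ (k + 1) : ℚ[X]) := by simp
    rw [this, ← Module.End.mul_apply, ← map_mul, mul_comm, map_mul, Module.End.mul_apply, hB,
      map_zero]
  set g := aeval seqShift (geomProd (k + 1 + 1)) h with hg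
  have h3 : ∀ n, g n = g 0 := by
    intro n
    induction n with
    | zero => rfl
    | succ n ih =>
      rw [map_mul, Module.End.mul_apply, ← hg, ← pow_one (X : ℚ[X])] at h2
      have := congrFun h2 n
      rw [aeval_seqShift_X_pow_sub_one] at this
      rw [← ih]
      exact sub_eq_zero.1 this
  set e := (geomProd (k + 1 + 1)).eval 1 with he
  have he0 : e ≠ 0 := eval_one_geomProd_ne_zero _
  refine ⟨Q + C (g 0 / e), ⟨?_, ?_⟩, ?_⟩
  · exact (natDegree_add_C).trans_le hQ
  · have : (fun n : ℕ => adjustedNumPartitions (k + 1) n - (Q + C (g 0 / e)).eval (n : ℚ)) =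
        h - fun _ => g 0 / e := by
      funext n
      simp only [hh, eval_add, eval_C, Pi.sub_apply]
      ring
    rw [this, map_sub, aeval_seqShift_const, ← hg, ← he, mul_div_cancel₀ _ he0]
    funext n
    simp [h3 n]
  · rw [map_add, taylor_C, ← hQA]
    ring

open Polynomial in
theorem exists_polynomial_parts : ∃ A : ℕ → ℚ[X], A 0 = 1 ∧ (∀ k, (A k).natDegree ≤ k) ∧
    (∀ k : ℕ, taylor ((k : ℚ) + 2) (A (k + 1)) - A (k + 1) = taylor ((k : ℚ) + 1) (A k)) ∧
    ∀ k, aeval seqShift (geomProd (k + 1))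
      (fun n => adjustedNumPartitions k n - (A k).eval (n : ℚ)) = 0 := by
  choose! next hnext using exists_polynomial_step
  let A : ℕ → ℚ[X] := fun k => Nat.rec 1 (fun k P => next k P) k
  have hA : ∀ k, (A k).natDegree ≤ k ∧ aeval seqShift (geomProd (k + 1))
      (fun n => adjustedNumPartitions k n - (A k).eval (n : ℚ)) = 0 := by
    intro k
    induction k with
    | zero =>
      refine ⟨natDegree_one.le, ?_⟩
      have : (fun n : ℕ => adjustedNumPartitions 0 n - (A 0).eval (n : ℚ)) = 0 := by
        funext n
        simp [A, adjustedNumPartitions]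
      rw [this, map_zero]
    | succ k ih => exact (hnext k (A k) ih.1 ih.2).1
  exact ⟨A, rfl, fun k => (hA k).1, fun k => (hnext k (A k) (hA k).1 (hA k).2).2,
    fun k => (hA k).2⟩

/-! ### Assembly -/

theorem mainTheorem10 :
    ∃ f : ℕ → ℕ → ℚ,
      IsTwoLevelQuasiPolynomial (Polynomial.X - 1)
        (fun q => ((((q : ℤ) - 1) / 2 : ℤ) : WithTop ℤ)) (fun _ => 1) f ∧
      ∀ q n : ℕ, 1 ≤ q → ¬ (q = 1 ∧ n = 0) →
        f q n = (q.factorial : ℚ) * ((q - 1).factorial : ℚ) * (numPartitions q n : ℚ) := by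
  obtain ⟨A, hA0, hdeg, hrec, hB⟩ := exists_polynomial_parts
  choose S hS using exists_polynomial_normalizedCoeff hdeg hrec
  have hsupp : ∀ q, q ∈ degreeSupport (Polynomial.X - 1) ↔ 1 ≤ q := by
    intro q
    simp [degreeSupport]
  have hnot : ∀ q, q ∉ degreeSupport (Polynomial.X - 1) → q = 0 := by
    intro q hq
    rw [hsupp] at hq
    omega
  refine ⟨fun q n => if q = 0 then 0 else
    (q.factorial : ℚ) * ((q - 1).factorial : ℚ) * adjustedNumPartitions (q - 1) n,
    ⟨fun q => ⟨q - 1, by simp⟩, ?_, ?_, fun _ => one_pos, fun _ => dvd_rfl, ?_, ?_, ?_⟩, ?_⟩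
  · filter_upwards [Filter.eventually_ge_atTop 1] with q hq
    exact (hsupp q).2 hq
  · intro q
    rw [WithTop.coe_le_coe]
    omega
  -- With k = q-1, the falling factorial k!/(k-r)! converts the normalization (k+1)!(k-r)! to
  -- q!(q-1)!.
  · refine ⟨fun r _ => ((descPochhammer ℚ r) * S r).comp (Polynomial.X - 1), fun q hq => ?_⟩
    rw [hsupp] at hq
    obtain ⟨k, rfl⟩ := Nat.exists_eq_add_of_le' hq
    obtain ⟨β, hper, hβ, hsum⟩ := exists_periodic_coeff_of_aeval_eq_zero
      (k + 1).factorial_pos (f := fun n => adjustedNumPartitions k n - (A k).eval (n : ℚ))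
      (m := (k + 1) / 2) (by
        obtain ⟨T, hT⟩ := geomProd_dvd (k + 1)
        rw [hT, mul_comm, map_mul, Module.End.mul_apply, hB, map_zero])
    have hlead : ∀ r, r ≤ k → ((k + 1).factorial : ℚ) * (k.factorial : ℚ) * (A k).coeff (k - r) =
        ((descPochhammer ℚ r) * S r).eval (k : ℚ) := by
      intro r hr
      rw [Polynomial.eval_mul, ← hS r k hr, descPochhammer_eval_eq_descFactorial,
        normalizedCoeff, ← Nat.factorial_mul_descFactorial hr]
      push_cast
      ring
    refine ⟨k, fun r n => if r ≤ k then ((k + 1).factorial : ℚ) * (k.factorial : ℚ) *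
      ((A k).coeff (k - r) + β (k - r) n) else 0, by simp, ⟨?_, ⟨0, ?_⟩, ?_, ?_⟩, ?_⟩
    · intro r
      refine ⟨(k + 1).factorial, (k + 1).factorial_pos, fun n => ?_⟩
      simp only [hper (k - r) n]
    · rw [if_pos k.zero_le, Nat.sub_zero, hβ k (by omega)]
      have h0 := normalizedCoeff_zero_eq hdeg hrec k
      have h1 : normalizedCoeff A 0 0 = 1 := by simp [normalizedCoeff, hA0]
      rw [h1, normalizedCoeff, Nat.sub_zero] at h0
      rw [Pi.zero_apply, add_zero, h0]
      exact one_ne_zero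
    · intro r hr n
      exact if_neg (by omega)
    · intro n
      have hfn : adjustedNumPartitions k n = ∑ j ∈ Finset.range (k + 1),
          ((A k).coeff j + β j n) * (n : ℚ) ^ j := by
        have h1 : ∑ j ∈ Finset.range ((k + 1) / 2), β j n * (n : ℚ) ^ j =
            ∑ j ∈ Finset.range (k + 1), β j n * (n : ℚ) ^ j := by
          refine Finset.sum_subset (Finset.range_subset_range.2 (by omega)) fun j _ hj => ?_
          rw [hβ j (by simpa using hj), Pi.zero_apply, zero_mul]
        have h2 := hsum n
        simp only [add_mul, Finset.sum_add_distrib]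
        rw [← h1, ← h2, ← Polynomial.eval_eq_sum_range' (Nat.lt_succ_of_le (hdeg k))]
        ring
      rw [if_neg k.succ_ne_zero, Nat.add_sub_cancel, hfn, ← Finset.sum_range_reflect,
        Finset.mul_sum]
      refine Finset.sum_congr rfl fun r hr => ?_
      have := Finset.mem_range.1 hr
      rw [if_pos (by omega), show k + 1 - 1 - r = k - r by omega]
      ring
    · intro n r hr
      rw [WithTop.coe_le_coe] at hr
      push_cast at hr
      have hr' : r ≤ k := by omega
      beta_reduce
      -- r ≤ ⌊k/2⌋ means k-r ≥ ⌊(k+1)/2⌋, where the periodic part vanishes.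
      rw [if_pos hr', hβ (k - r) (by omega), Pi.zero_apply, add_zero, hlead r hr']
      simp
  · intro q hq n
    exact if_pos (hnot q hq)
  · intro q hq
    -- Integer division rounds down here: (0-1)/2 = -1.
    rw [hnot q hq]
    rfl
  · intro q n hq hqn
    simp only [adjustedNumPartitions]
    rw [if_neg (by omega)]
    split_ifs with h
    · obtain rfl : q = 1 := by omega
      obtain ⟨n, rfl⟩ := Nat.exists_eq_succ_of_ne_zero (fun h => hqn ⟨rfl, h⟩)
      rw [numPartitions_one_succ]
      norm_num
    · rw [Nat.sub_add_cancel hq]
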